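/- By a $C^*$-algebra we mean a complex, not necessarily unital or separable, $C^*$-algebra, and for $C^*$-algebras $C$ and $A$ let $\mathrm{Hom}(C,A)$ be the set of all $*$-homomorphisms $C\to A$ (not required to preserve units). Two elements $f_0,f_1\in \mathrm{Hom}(C,A)$ are homotopic if there is a $*$-homomorphism $F:C\to C([0,1],A)$ with $F(c)(0)=f_0(c)$ and $F(c)(1)=f_1(c)$ for all $c\in C$. Two $C^*$-algebras $A$ and $B$ are called weakly homotopy equivalent if for every separable $C^*$-algebra $C$ there are maps $\varphi_C:\mathrm{Hom}(C,A)\to \mathrm{Hom}(C,B)$ and $\psi_C:\mathrm{Hom}(C,B)\to \mathrm{Hom}(C,A)$ that are natural in $C$ (that is, $\varphi_D(f\circ h)=\varphi_C(f)\circ h$ and $\psi_D(g\circ h)=\psi_C(g)\circ h$ for every $*$-homomorphism $h:D\to C$ of separable $C^*$-algebras), send homotopic $*$-homomorphisms to homotopic ones, and are such that for every separable $C$ the $*$-homomorphism $\psi_C(\varphi_C(f))$ is homotopic to $f$ for all $f\in \mathrm{Hom}(C,A)$, and $\varphi_C(\psi_C(g))$ is homotopic to $g$ for all $g\in \mathrm{Hom}(C,B)$.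 **Lemma.** If $A$ and $B$ are weakly homotopy equivalent $C^*$-algebras, then $K_0(A)\cong K_0(B)$ and $K_1(A)\cong K_1(B)$ as abelian groups. Here, for a unital $C^*$-algebra $D$, $K_0(D)$ is the abelian group generated by the symbols $[p]$, $p$ a projection in $M_n(D)$, $n\in\mathbb N$, subject to the relations $[p]=[q]$ if $p,q\in M_n(D)$ are joined by a norm-continuous path of projections in $M_n(D)$, $[0]=0$, and $[p]+[q]=[p\oplus q]$; and $K_1(D)$ is the abelian group generated by the symbols $[w]$, $w$ a unitary in $M_n(D)$, subject to $[w]=[z]$ if $w,z\in M_n(D)$ are joined by a norm-continuous path of unitaries in $M_n(D)$, $[1]=0$, and $[w]+[z]=[w\oplus z]$. For an arbitrary $C^*$-algebra $A$ with unitization $A^+$ (a unit being adjoined even if $A$ has one), $K_0(A)=\ker(K_0(A^+)\to K_0(\mathbb C))$ and $K_1(A)=K_1(A^+)$. -/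

import Mathlib

open scoped unitInterval

universe u v

section Homotopy

/-- Two `*`-homomorphisms `f₀ f₁ : C → B` of (not necessarily unital) C⋆-algebras are homotopic
if there is a `*`-homomorphism `F : C → C([0,1], B)` with `ev₀ ∘ F = f₀` and `ev₁ ∘ F = f₁`. -/
def StarHomotopic {C : Type u} {B : Type v} [NonUnitalCStarAlgebra C] [NonUnitalCStarAlgebra B]
    (f₀ f₁ : C →⋆ₙₐ[ℂ] B) : Prop :=
  ∃ F : C →⋆ₙₐ[ℂ] C(I, B), (∀ c, F c 0 = f₀ c) ∧ (∀ c, F c 1 = f₁ c)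

/-- A map from `*`-homomorphisms `C → A` to `*`-homomorphisms `C → B`, one for every separable
C⋆-algebra `C`. -/
abbrev SeparableHomMap (A B : Type u) [NonUnitalCStarAlgebra A] [NonUnitalCStarAlgebra B] :
    Type (u + 1) :=
  ∀ (C : Type u) [NonUnitalCStarAlgebra C] [TopologicalSpace.SeparableSpace C],
    (C →⋆ₙₐ[ℂ] A) → (C →⋆ₙₐ[ℂ] B)

/-- Naturality in the separable C⋆-algebra `C`. -/
def SeparableHomMap.IsNatural {A B : Type u} [NonUnitalCStarAlgebra A] [NonUnitalCStarAlgebra B]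
    (φ : SeparableHomMap A B) : Prop :=
  ∀ (C D : Type u) [NonUnitalCStarAlgebra C] [TopologicalSpace.SeparableSpace C]
    [NonUnitalCStarAlgebra D] [TopologicalSpace.SeparableSpace D]
    (h : D →⋆ₙₐ[ℂ] C) (f : C →⋆ₙₐ[ℂ] A), φ D (f.comp h) = (φ C f).comp h

/-- Homotopic `*`-homomorphisms are sent to homotopic ones. -/
def SeparableHomMap.PreservesHomotopy {A B : Type u} [NonUnitalCStarAlgebra A]
    [NonUnitalCStarAlgebra B] (φ : SeparableHomMap A B) : Prop :=
  ∀ (C : Type u) [NonUnitalCStarAlgebra C] [TopologicalSpace.SeparableSpace C]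
    (f₀ f₁ : C →⋆ₙₐ[ℂ] A), StarHomotopic f₀ f₁ → StarHomotopic (φ C f₀) (φ C f₁)

/-- Weak homotopy equivalence of C⋆-algebras. -/
def WeaklyHomotopyEquivalent (A B : Type u) [NonUnitalCStarAlgebra A]
    [NonUnitalCStarAlgebra B] : Prop :=
  ∃ (φ : SeparableHomMap A B) (ψ : SeparableHomMap B A),
    φ.IsNatural ∧ ψ.IsNatural ∧ φ.PreservesHomotopy ∧ ψ.PreservesHomotopy ∧
    (∀ (C : Type u) [NonUnitalCStarAlgebra C] [TopologicalSpace.SeparableSpace C]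
      (f : C →⋆ₙₐ[ℂ] A), StarHomotopic (ψ C (φ C f)) f) ∧
    (∀ (C : Type u) [NonUnitalCStarAlgebra C] [TopologicalSpace.SeparableSpace C]
      (g : C →⋆ₙₐ[ℂ] B), StarHomotopic (φ C (ψ C g)) g)

end Homotopy

namespace KTheory

/-! The topology on `Matrix (Fin n) (Fin n) A` is the entrywise one, which is the topology of the
C⋆-norm on `Mₙ(A)`; `star` is the conjugate transpose. -/

/-- The block sum `x ⊕ y = diag(x, y)` in `M_{m+n}(A)`. -/
def blockSum {A : Type u} [Zero A] {m n : ℕ} (x : Matrix (Fin m) (Fin m) A)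
    (y : Matrix (Fin n) (Fin n) A) : Matrix (Fin (m + n)) (Fin (m + n)) A :=
  Matrix.reindex finSumFinEquiv finSumFinEquiv (Matrix.fromBlocks x 0 0 y)

section Unital

variable (A : Type u) [CStarAlgebra A]

/-- Projections in `Mₙ(A)`, `n ∈ ℕ`. -/
abbrev MatProj : Type u :=
  Σ n : ℕ, {p : Matrix (Fin n) (Fin n) A // IsStarProjection p}

/-- Unitaries in `Mₙ(A)`, `n ∈ ℕ`. -/
abbrev MatUnitary : Type u :=
  Σ n : ℕ, {w : Matrix (Fin n) (Fin n) A // w ∈ unitary (Matrix (Fin n) (Fin n) A)}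

variable {A}

theorem star_blockSum {m n : ℕ} (x : Matrix (Fin m) (Fin m) A) (y : Matrix (Fin n) (Fin n) A) :
    star (blockSum x y) = blockSum (star x) (star y) := by
  simp [blockSum, Matrix.star_eq_conjTranspose, Matrix.fromBlocks_conjTranspose]

theorem blockSum_mul {m n : ℕ} (x x' : Matrix (Fin m) (Fin m) A)
    (y y' : Matrix (Fin n) (Fin n) A) :
    blockSum x y * blockSum x' y' = blockSum (x * x') (y * y') := by
  simp [blockSum, Matrix.submatrix_mul_equiv, Matrix.fromBlocks_multiply]

theorem blockSum_one {m n : ℕ} :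
    blockSum (1 : Matrix (Fin m) (Fin m) A) (1 : Matrix (Fin n) (Fin n) A) = 1 := by
  simp [blockSum, Matrix.fromBlocks_one]

theorem isStarProjection_blockSum {m n : ℕ} {p : Matrix (Fin m) (Fin m) A}
    {q : Matrix (Fin n) (Fin n) A} (hp : IsStarProjection p) (hq : IsStarProjection q) :
    IsStarProjection (blockSum p q) where
  isIdempotentElem := by
    rw [IsIdempotentElem, blockSum_mul, hp.isIdempotentElem, hq.isIdempotentElem]
  isSelfAdjoint := by
    rw [IsSelfAdjoint, star_blockSum, hp.isSelfAdjoint, hq.isSelfAdjoint]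

theorem blockSum_mem_unitary {m n : ℕ} {w : Matrix (Fin m) (Fin m) A}
    {z : Matrix (Fin n) (Fin n) A} (hw : w ∈ unitary (Matrix (Fin m) (Fin m) A))
    (hz : z ∈ unitary (Matrix (Fin n) (Fin n) A)) :
    blockSum w z ∈ unitary (Matrix (Fin (m + n)) (Fin (m + n)) A) := by
  rw [Unitary.mem_iff] at *
  rw [star_blockSum, blockSum_mul, blockSum_mul, hw.1, hw.2, hz.1, hz.2, blockSum_one]
  exact ⟨rfl, rfl⟩

variable (A)

/-- The defining relations of `K₀` of a unital C⋆-algebra: `[p] = [q]` if `p, q ∈ Mₙ(A)` are joined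
by a path of projections in `Mₙ(A)`; `[0] = 0`; and `[p] + [q] = [p ⊕ q]`. -/
inductive K0Rel : FreeAbelianGroup (MatProj A) → Prop
  | path {n : ℕ} (p q : Matrix (Fin n) (Fin n) A) (hp : IsStarProjection p)
      (hq : IsStarProjection q) (h : JoinedIn {r | IsStarProjection r} p q) :
      K0Rel (FreeAbelianGroup.of ⟨n, p, hp⟩ - FreeAbelianGroup.of ⟨n, q, hq⟩)
  | zero (n : ℕ) : K0Rel (FreeAbelianGroup.of ⟨n, 0, IsStarProjection.zero _⟩)
  | sum {m n : ℕ} (p : Matrix (Fin m) (Fin m) A) (q : Matrix (Fin n) (Fin n) A)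
      (hp : IsStarProjection p) (hq : IsStarProjection q) :
      K0Rel (FreeAbelianGroup.of ⟨m, p, hp⟩ + FreeAbelianGroup.of ⟨n, q, hq⟩
        - FreeAbelianGroup.of ⟨m + n, blockSum p q, isStarProjection_blockSum hp hq⟩)

/-- The defining relations of `K₁` of a unital C⋆-algebra: `[w] = [z]` if `w, z ∈ Uₙ(A)` are joined
by a path in `Uₙ(A)`; `[1] = 0`; and `[w] + [z] = [w ⊕ z]`. -/
inductive K1Rel : FreeAbelianGroup (MatUnitary A) → Prop
  | path {n : ℕ} (w z : Matrix (Fin n) (Fin n) A) (hw : w ∈ unitary (Matrix (Fin n) (Fin n) A))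
      (hz : z ∈ unitary (Matrix (Fin n) (Fin n) A))
      (h : JoinedIn (unitary (Matrix (Fin n) (Fin n) A) : Set (Matrix (Fin n) (Fin n) A)) w z) :
      K1Rel (FreeAbelianGroup.of ⟨n, w, hw⟩ - FreeAbelianGroup.of ⟨n, z, hz⟩)
  | one (n : ℕ) : K1Rel (FreeAbelianGroup.of ⟨n, 1, one_mem _⟩)
  | sum {m n : ℕ} (w : Matrix (Fin m) (Fin m) A) (z : Matrix (Fin n) (Fin n) A)
      (hw : w ∈ unitary (Matrix (Fin m) (Fin m) A))
      (hz : z ∈ unitary (Matrix (Fin n) (Fin n) A)) :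
      K1Rel (FreeAbelianGroup.of ⟨m, w, hw⟩ + FreeAbelianGroup.of ⟨n, z, hz⟩
        - FreeAbelianGroup.of ⟨m + n, blockSum w z, blockSum_mem_unitary hw hz⟩)

/-- `K₀` of a unital C⋆-algebra. -/
abbrev K0Unital : Type u :=
  FreeAbelianGroup (MatProj A) ⧸ AddSubgroup.closure {x | K0Rel A x}

/-- `K₁` of a unital C⋆-algebra. -/
abbrev K1Unital : Type u :=
  FreeAbelianGroup (MatUnitary A) ⧸ AddSubgroup.closure {x | K1Rel A x}

end Unital

section Functoriality

variable {A : Type u} {B : Type v} [CStarAlgebra A] [CStarAlgebra B]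

theorem isStarProjection_map (f : A →⋆ₐ[ℂ] B) {n : ℕ} {p : Matrix (Fin n) (Fin n) A}
    (hp : IsStarProjection p) : IsStarProjection (p.map f) where
  isIdempotentElem := by
    rw [IsIdempotentElem, ← Matrix.map_mul, hp.isIdempotentElem]
  isSelfAdjoint := by
    have h := hp.isSelfAdjoint
    rw [IsSelfAdjoint, Matrix.star_eq_conjTranspose] at h ⊢
    rw [← Matrix.conjTranspose_map f (fun a => map_star f a), h]

theorem map_blockSum (f : A →⋆ₐ[ℂ] B) {m n : ℕ} (x : Matrix (Fin m) (Fin m) A)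
    (y : Matrix (Fin n) (Fin n) A) :
    (blockSum x y).map f = blockSum (x.map f) (y.map f) := by
  simp [blockSum, ← Matrix.submatrix_map, Matrix.fromBlocks_map]

/-- Entrywise application of a unital `*`-homomorphism to matrix projections. -/
def MatProj.map (f : A →⋆ₐ[ℂ] B) (p : MatProj A) : MatProj B :=
  ⟨p.1, p.2.1.map f, isStarProjection_map f p.2.2⟩

theorem K0Rel.map (f : A →⋆ₐ[ℂ] B) {x : FreeAbelianGroup (MatProj A)} (hx : K0Rel A x) :
    K0Rel B (FreeAbelianGroup.map (MatProj.map f) x) := by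
  cases hx with
  | @path n p q hp hq h =>
    simp only [map_sub, FreeAbelianGroup.map_of_apply, MatProj.map]
    refine K0Rel.path _ _ _ _ ?_
    have hc : Continuous (fun r : Matrix (Fin n) (Fin n) A => r.map f) :=
      continuous_id.matrix_map
        (NonUnitalStarAlgHom.instContinuousLinearMapClassComplex (F := A →⋆ₐ[ℂ] B).map_continuous f)
    obtain ⟨γ, hγ⟩ := h
    exact ⟨γ.map hc, fun t => isStarProjection_map f (hγ t)⟩
  | zero n =>
    simp only [FreeAbelianGroup.map_of_apply, MatProj.map, Matrix.map_zero f (map_zero f)]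
    exact K0Rel.zero n
  | sum p q hp hq =>
    simp only [map_sub, map_add, FreeAbelianGroup.map_of_apply, MatProj.map, map_blockSum]
    exact K0Rel.sum _ _ _ _

/-- The homomorphism `K₀(A) → K₀(B)` induced by a unital `*`-homomorphism `A → B`. -/
def K0Unital.map (f : A →⋆ₐ[ℂ] B) : K0Unital A →+ K0Unital B :=
  QuotientAddGroup.map _ _ (FreeAbelianGroup.map (MatProj.map f)) <| by
    rw [AddSubgroup.closure_le]
    exact fun x hx => AddSubgroup.subset_closure (K0Rel.map f hx)

end Functoriality

section NonUnital

variable (A : Type u) [NonUnitalCStarAlgebra A]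

/-- The quotient `*`-homomorphism `A⁺ → ℂ` of the unitization `A⁺` of `A`. -/
def augmentation : Unitization ℂ A →⋆ₐ[ℂ] ℂ :=
  { Unitization.fstHom ℂ A with map_star' := fun x => Unitization.fst_star x }

/-- `K₀(A) = ker (K₀(A⁺) → K₀(ℂ))`. -/
abbrev K0 : Type u :=
  (K0Unital.map (augmentation A)).ker

/-- `K₁(A) = K₁(A⁺)`. -/
abbrev K1 : Type u :=
  K1Unital (Unitization ℂ A)

end NonUnital

end KTheory

/-! ### Separable C⋆-subalgebras -/

section Separability

/-! Any two elements of `A` lie in a common separable C⋆-subalgebra, so a natural family `φ` is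
determined by its values on inclusions of such subalgebras. By naturality these values fit together
into one `*`-homomorphism `A → B`, and `φ` is composition with it (`SeparableHomMap.eq_glue_comp` in
`IsNatural`). A weak equivalence thus amounts to `f : A → B` and `g : B → A` whose composites are
homotopic to the identity after restriction to each separable C⋆-subalgebra.

This suffices for K-theory: a matrix over `A⁺` has finitely many entries, so it comes from the
unitization of a separable subalgebra. A homotopy there yields a path of projections or unitaries
from its image under `g ∘ f` to the matrix itself. Hence `f` and `g` induce inverse maps on `K₀` and
`K₁` of the unitizations; compatibility with the augmentations restricts the first to the kernels.
-/

theorem Subsemigroup.countable_closure {M : Type*} [Semigroup M] {s : Set M} (hs : s.Countable) :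
    (Subsemigroup.closure s : Set M).Countable := by
  have := hs.to_subtype
  have : Countable (FreeSemigroup s) :=
    Function.Injective.countable (f := fun x : FreeSemigroup s => (x.head, x.tail))
      fun x y h => FreeSemigroup.ext (congrArg Prod.fst h) (congrArg Prod.snd h)
  have hle : Subsemigroup.closure s ≤ (FreeSemigroup.lift ((↑) : s → M)).srange :=
    Subsemigroup.closure_le.2 fun x hx => ⟨FreeSemigroup.of ⟨x, hx⟩, FreeSemigroup.lift_of _ _⟩
  exact (Set.countable_range (FreeSemigroup.lift ((↑) : s → M))).mono hle

variable {A : Type u} [NonUnitalCStarAlgebra A]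

/-- The C⋆-subalgebra generated by a set. -/
abbrev cstarClosure (s : Set A) : NonUnitalStarSubalgebra ℂ A :=
  (NonUnitalStarAlgebra.adjoin ℂ s).topologicalClosure

instance isClosed_cstarClosure (s : Set A) : IsClosed (cstarClosure s : Set A) :=
  NonUnitalStarSubalgebra.isClosed_topologicalClosure _

theorem subset_cstarClosure (s : Set A) : s ⊆ cstarClosure s :=
  (NonUnitalStarAlgebra.subset_adjoin ℂ s).trans
    (NonUnitalStarSubalgebra.le_topologicalClosure _)

theorem cstarClosure_le {s : Set A} {S : NonUnitalStarSubalgebra ℂ A} (hS : IsClosed (S : Set A))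
    (hs : s ⊆ S) : cstarClosure s ≤ S :=
  NonUnitalStarSubalgebra.topologicalClosure_minimal _ (NonUnitalStarAlgebra.adjoin_le hs) hS

/-- The generated `*`-algebra is the linear span of the countable semigroup of words in `s ∪ star
s`; spans over `ℂ` and closures preserve separability. -/
theorem separableSpace_cstarClosure {s : Set A} (hs : s.Countable) :
    TopologicalSpace.SeparableSpace (cstarClosure s) := by
  have hstar : (star s).Countable := by
    rw [← Set.image_star]
    exact hs.image _
  have hsep : TopologicalSpace.IsSeparable (NonUnitalStarAlgebra.adjoin ℂ s : Set A) := by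
    have h := (Subsemigroup.countable_closure (hs.union hstar)).isSeparable.span (R := ℂ)
    rw [← NonUnitalStarAlgebra.adjoin_eq_span] at h
    exact h
  exact hsep.closure.separableSpace

instance separableSpace_cstarClosure_singleton (a : A) :
    TopologicalSpace.SeparableSpace (cstarClosure {a}) :=
  separableSpace_cstarClosure (Set.countable_singleton a)

/-- The inclusion of a generated C⋆-subalgebra. -/
abbrev cstarInclusion (s : Set A) : cstarClosure s →⋆ₙₐ[ℂ] A :=
  NonUnitalStarSubalgebraClass.subtype (cstarClosure s)

end Separability

/-! ### Natural maps as composition with a `*`-homomorphism -/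

namespace SeparableHomMap

variable {A B : Type u} [NonUnitalCStarAlgebra A] [NonUnitalCStarAlgebra B]

/-- The value at `a` of the `*`-homomorphism that represents a natural map. -/
noncomputable def glueFun (φ : SeparableHomMap A B) (a : A) : B :=
  φ (cstarClosure {a}) (cstarInclusion {a}) ⟨a, subset_cstarClosure _ rfl⟩

/-- The restriction of `f` to the subalgebra generated by `c` factors through the one generated by
`f c`. Naturality along the inclusion of the former and along the corestricted map computes `φ` of
this restriction in two ways; evaluate both at `c`. -/
theorem IsNatural.apply_eq_glueFun {φ : SeparableHomMap A B} (hφ : φ.IsNatural) (C : Type u)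
    [NonUnitalCStarAlgebra C] [TopologicalSpace.SeparableSpace C] (f : C →⋆ₙₐ[ℂ] A) (c : C) :
    φ C f c = φ.glueFun (f c) := by
  have hf : Continuous f :=
    NonUnitalStarAlgHom.instContinuousLinearMapClassComplex (F := C →⋆ₙₐ[ℂ] A).map_continuous f
  have hmem : ∀ x : cstarClosure {c}, f.comp (cstarInclusion {c}) x ∈ cstarClosure {f c} := by
    have hle : cstarClosure {c} ≤ (cstarClosure {f c}).comap f :=
      cstarClosure_le ((isClosed_cstarClosure {f c}).preimage hf)
        (Set.singleton_subset_iff.2 (subset_cstarClosure {f c} rfl))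
    exact fun x => hle x.2
  have h₁ := hφ C (cstarClosure {c}) (cstarInclusion {c}) f
  have h₂ := hφ (cstarClosure {f c}) (cstarClosure {c})
    (NonUnitalStarAlgHom.codRestrict (f.comp (cstarInclusion {c})) _ hmem) (cstarInclusion {f c})
  rw [NonUnitalStarAlgHom.subtype_comp_codRestrict] at h₂
  exact DFunLike.congr_fun (h₁.symm.trans h₂) ⟨c, subset_cstarClosure _ rfl⟩

/-- `glueFun` uses a different subalgebra for each element. Each algebraic identity involves at most
two elements, so it can be checked inside one subalgebra, where a genuine `*`-homomorphism is
available. -/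
theorem IsNatural.exists_algHom_eq_glueFun {φ : SeparableHomMap A B} (hφ : φ.IsNatural) (a b : A) :
    ∃ (C : NonUnitalStarSubalgebra ℂ A) (g : C →⋆ₙₐ[ℂ] B), a ∈ C ∧ b ∈ C ∧
      ∀ c : C, φ.glueFun c = g c := by
  have := separableSpace_cstarClosure (Set.toFinite {a, b}).countable
  exact ⟨cstarClosure {a, b}, φ _ (cstarInclusion {a, b}), subset_cstarClosure _ (by simp),
    subset_cstarClosure _ (by simp), fun c => (hφ.apply_eq_glueFun _ (cstarInclusion {a, b}) c).symm⟩

/-- A natural map is composition with a `*`-homomorphism, since every C⋆-algebra is the union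
of its separable C⋆-subalgebras. -/
noncomputable def glue (φ : SeparableHomMap A B) (hφ : φ.IsNatural) : A →⋆ₙₐ[ℂ] B where
  toFun := φ.glueFun
  map_smul' r a := by
    obtain ⟨C, g, ha, -, h⟩ := hφ.exists_algHom_eq_glueFun a a
    have hg := map_smul g r ⟨a, ha⟩
    rwa [← h, ← h] at hg
  map_zero' := by
    obtain ⟨C, g, -, -, h⟩ := hφ.exists_algHom_eq_glueFun (0 : A) 0
    have hg := map_zero g
    rwa [← h] at hg
  map_add' a b := by
    obtain ⟨C, g, ha, hb, h⟩ := hφ.exists_algHom_eq_glueFun a b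
    have hg := map_add g ⟨a, ha⟩ ⟨b, hb⟩
    rwa [← h, ← h, ← h] at hg
  map_mul' a b := by
    obtain ⟨C, g, ha, hb, h⟩ := hφ.exists_algHom_eq_glueFun a b
    have hg := map_mul g ⟨a, ha⟩ ⟨b, hb⟩
    rwa [← h, ← h, ← h] at hg
  map_star' a := by
    obtain ⟨C, g, ha, -, h⟩ := hφ.exists_algHom_eq_glueFun a a
    have hg := map_star g ⟨a, ha⟩
    rwa [← h, ← h] at hg

theorem IsNatural.eq_glue_comp {φ : SeparableHomMap A B} (hφ : φ.IsNatural) (C : Type u)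
    [NonUnitalCStarAlgebra C] [TopologicalSpace.SeparableSpace C] (f : C →⋆ₙₐ[ℂ] A) :
    φ C f = (φ.glue hφ).comp f :=
  NonUnitalStarAlgHom.ext fun c => hφ.apply_eq_glueFun C f c

end SeparableHomMap

namespace KTheory

/-! ### Paths of matrices from homotopies -/

section HomotopyInvariance

variable {C : Type u} {B : Type v} [NonUnitalCStarAlgebra C] [NonUnitalCStarAlgebra B]

/-- Homotopic `*`-homomorphisms send a matrix over `C⁺` to the endpoints of a path, each point of
which is the image of that matrix under a unital `*`-homomorphism. -/
theorem _root_.StarHomotopic.joinedIn_map {f₀ f₁ : C →⋆ₙₐ[ℂ] B} (h : StarHomotopic f₀ f₁) {n : ℕ}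
    (x : Matrix (Fin n) (Fin n) (Unitization ℂ C))
    (P : Set (Matrix (Fin n) (Fin n) (Unitization ℂ B)))
    (hP : ∀ f : Unitization ℂ C →⋆ₐ[ℂ] Unitization ℂ B, x.map f ∈ P) :
    JoinedIn P (x.map (Unitization.starMap f₀)) (x.map (Unitization.starMap f₁)) := by
  obtain ⟨F, h0, h1⟩ := h
  let G (t : I) : C →⋆ₙₐ[ℂ] B :=
    { toFun := fun c => F c t
      map_smul' := fun r c => by simp
      map_zero' := by simp
      map_add' := fun a b => by simp
      map_mul' := fun a b => by simp
      map_star' := fun a => by simp [map_star] }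
  have hG0 : G 0 = f₀ := NonUnitalStarAlgHom.ext h0
  have hG1 : G 1 = f₁ := NonUnitalStarAlgHom.ext h1
  have hcont : Continuous fun t => x.map (Unitization.starMap (G t)) := by
    refine continuous_matrix fun i j => ?_
    -- The scalar part of an entry does not move; only the `B`-part depends on `t`, through an
    -- element of `C(I, B)`.
    have hij : ∀ t, x.map (Unitization.starMap (G t)) i j =
        algebraMap ℂ (Unitization ℂ B) (x i j).fst + Unitization.inr (F (x i j).snd t) := by
      intro t
      rw [Matrix.map_apply]
      nth_rewrite 1 [← Unitization.inl_fst_add_inr_snd_eq (x i j)]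
      rw [map_add, Unitization.starMap_inl, Unitization.starMap_inr]
      rfl
    simp_rw [hij]
    exact continuous_const.add (Unitization.continuous_inr.comp (F (x i j).snd).continuous)
  exact ⟨⟨⟨_, hcont⟩, by simp only [hG0], by simp only [hG1]⟩, fun t => hP (Unitization.starMap (G t))⟩

end HomotopyInvariance

/-! ### Functoriality of `K₀` and `K₁` -/

section Functoriality

variable {A B C : Type*} [CStarAlgebra A] [CStarAlgebra B] [CStarAlgebra C]

theorem K0Unital.map_mk_of (f : A →⋆ₐ[ℂ] B) (p : MatProj A) :
    K0Unital.map f (QuotientAddGroup.mk (FreeAbelianGroup.of p)) =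
      QuotientAddGroup.mk (FreeAbelianGroup.of (p.map f)) := by
  simp [K0Unital.map]

theorem K0Unital.hom_ext {G : Type*} [AddCommGroup G] {f g : K0Unital A →+ G}
    (h : ∀ p : MatProj A, f (QuotientAddGroup.mk (FreeAbelianGroup.of p)) =
      g (QuotientAddGroup.mk (FreeAbelianGroup.of p))) : f = g :=
  QuotientAddGroup.addMonoidHom_ext _ (FreeAbelianGroup.lift_ext _ _ h)

theorem K0Unital.map_comp (g : B →⋆ₐ[ℂ] C) (f : A →⋆ₐ[ℂ] B) :
    K0Unital.map (g.comp f) = (K0Unital.map g).comp (K0Unital.map f) :=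
  K0Unital.hom_ext fun p => by
    rw [AddMonoidHom.comp_apply, K0Unital.map_mk_of, K0Unital.map_mk_of, K0Unital.map_mk_of]
    rfl

theorem map_mem_unitary (f : A →⋆ₐ[ℂ] B) {n : ℕ} {w : Matrix (Fin n) (Fin n) A}
    (hw : w ∈ unitary (Matrix (Fin n) (Fin n) A)) :
    w.map f ∈ unitary (Matrix (Fin n) (Fin n) B) := by
  rw [Unitary.mem_iff, Matrix.star_eq_conjTranspose] at hw ⊢
  rw [← Matrix.conjTranspose_map f (fun a => map_star f a), ← Matrix.map_mul, ← Matrix.map_mul,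
    hw.1, hw.2, Matrix.map_one f (map_zero f) (map_one f)]
  exact ⟨rfl, rfl⟩

/-- Entrywise application of a unital `*`-homomorphism to matrix unitaries. -/
def MatUnitary.map (f : A →⋆ₐ[ℂ] B) (w : MatUnitary A) : MatUnitary B :=
  ⟨w.1, w.2.1.map f, map_mem_unitary f w.2.2⟩

theorem K1Rel.map (f : A →⋆ₐ[ℂ] B) {x : FreeAbelianGroup (MatUnitary A)} (hx : K1Rel A x) :
    K1Rel B (FreeAbelianGroup.map (MatUnitary.map f) x) := by
  cases hx with
  | @path n w z hw hz h =>
    simp only [map_sub, FreeAbelianGroup.map_of_apply, MatUnitary.map]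
    refine K1Rel.path _ _ _ _ ?_
    have hc : Continuous (fun r : Matrix (Fin n) (Fin n) A => r.map f) :=
      continuous_id.matrix_map
        (NonUnitalStarAlgHom.instContinuousLinearMapClassComplex (F := A →⋆ₐ[ℂ] B).map_continuous f)
    obtain ⟨γ, hγ⟩ := h
    exact ⟨γ.map hc, fun t => map_mem_unitary f (hγ t)⟩
  | one n =>
    simp only [FreeAbelianGroup.map_of_apply, MatUnitary.map,
      Matrix.map_one f (map_zero f) (map_one f)]
    exact K1Rel.one n
  | sum w z hw hz =>
    simp only [map_sub, map_add, FreeAbelianGroup.map_of_apply, MatUnitary.map, map_blockSum]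
    exact K1Rel.sum _ _ _ _

/-- The homomorphism `K₁(A) → K₁(B)` induced by a unital `*`-homomorphism `A → B`. -/
def K1Unital.map (f : A →⋆ₐ[ℂ] B) : K1Unital A →+ K1Unital B :=
  QuotientAddGroup.map _ _ (FreeAbelianGroup.map (MatUnitary.map f)) <| by
    rw [AddSubgroup.closure_le]
    exact fun x hx => AddSubgroup.subset_closure (K1Rel.map f hx)

theorem K1Unital.map_mk_of (f : A →⋆ₐ[ℂ] B) (w : MatUnitary A) :
    K1Unital.map f (QuotientAddGroup.mk (FreeAbelianGroup.of w)) =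
      QuotientAddGroup.mk (FreeAbelianGroup.of (w.map f)) := by
  simp [K1Unital.map]

theorem K1Unital.hom_ext {G : Type*} [AddCommGroup G] {f g : K1Unital A →+ G}
    (h : ∀ w : MatUnitary A, f (QuotientAddGroup.mk (FreeAbelianGroup.of w)) =
      g (QuotientAddGroup.mk (FreeAbelianGroup.of w))) : f = g :=
  QuotientAddGroup.addMonoidHom_ext _ (FreeAbelianGroup.lift_ext _ _ h)

theorem K1Unital.map_comp (g : B →⋆ₐ[ℂ] C) (f : A →⋆ₐ[ℂ] B) :
    K1Unital.map (g.comp f) = (K1Unital.map g).comp (K1Unital.map f) :=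
  K1Unital.hom_ext fun p => by
    rw [AddMonoidHom.comp_apply, K1Unital.map_mk_of, K1Unital.map_mk_of, K1Unital.map_mk_of]
    rfl

/-- Used to see that a projection over `A⁺`, once lifted to the unitization of a subalgebra, is
already a projection there. -/
theorem isStarProjection_map_iff {f : A →⋆ₐ[ℂ] B} (hf : Function.Injective f) {n : ℕ}
    {p : Matrix (Fin n) (Fin n) A} : IsStarProjection (p.map f) ↔ IsStarProjection p := by
  refine ⟨fun h => ⟨?_, ?_⟩, isStarProjection_map f⟩
  · apply Matrix.map_injective hf
    change (p * p).map f = p.map f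
    rw [Matrix.map_mul]
    exact h.isIdempotentElem
  · apply Matrix.map_injective hf
    change p.conjTranspose.map f = p.map f
    rw [Matrix.conjTranspose_map f (fun a => map_star f a)]
    exact h.isSelfAdjoint

theorem map_mem_unitary_iff {f : A →⋆ₐ[ℂ] B} (hf : Function.Injective f) {n : ℕ}
    {w : Matrix (Fin n) (Fin n) A} :
    w.map f ∈ unitary (Matrix (Fin n) (Fin n) B) ↔ w ∈ unitary (Matrix (Fin n) (Fin n) A) := by
  refine ⟨fun h => ?_, map_mem_unitary f⟩
  rw [Unitary.mem_iff, Matrix.star_eq_conjTranspose] at h ⊢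
  rw [← Matrix.conjTranspose_map f (fun a => map_star f a), ← Matrix.map_mul, ← Matrix.map_mul,
    ← Matrix.map_one f (map_zero f) (map_one f)] at h
  exact ⟨Matrix.map_injective hf h.1, Matrix.map_injective hf h.2⟩

end Functoriality

/-! ### Invariance under homotopy on separable subalgebras -/

section SeparableHomotopy

variable {A B : Type u} [NonUnitalCStarAlgebra A] [NonUnitalCStarAlgebra B]

/-- The finitely many `A`-components of the entries generate a suitable subalgebra; the scalar parts
lie in every unitization. -/
theorem exists_map_cstarInclusion_eq {n : ℕ} (x : Matrix (Fin n) (Fin n) (Unitization ℂ A)) :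
    ∃ (s : Set A) (_ : s.Countable)
      (y : Matrix (Fin n) (Fin n) (Unitization ℂ (cstarClosure s))),
      y.map (Unitization.starMap (cstarInclusion s)) = x := by
  let s : Set A := Set.range fun ij : Fin n × Fin n => (x ij.1 ij.2).snd
  refine ⟨s, Set.countable_range _, Matrix.of fun i j => Unitization.inl (x i j).fst +
    Unitization.inr ⟨(x i j).snd, subset_cstarClosure s ⟨(i, j), rfl⟩⟩, ?_⟩
  ext1 i j
  rw [Matrix.map_apply, Matrix.of_apply, map_add, Unitization.starMap_inl,
    Unitization.starMap_inr]
  exact Unitization.inl_fst_add_inr_snd_eq (x i j)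

theorem starMap_cstarInclusion_injective (s : Set A) :
    Function.Injective (Unitization.starMap (cstarInclusion s)) :=
  Unitization.starMap_injective Subtype.val_injective

/-- A `*`-endomorphism is separably homotopic to the identity if this holds on every separable
C⋆-subalgebra. -/
def IsSeparablyHomotopicToId (g : A →⋆ₙₐ[ℂ] A) : Prop :=
  ∀ s : Set A, s.Countable → StarHomotopic (g.comp (cstarInclusion s)) (cstarInclusion s)

theorem map_starMap_comp (g : A →⋆ₙₐ[ℂ] B) (s : Set A) {n : ℕ}
    (y : Matrix (Fin n) (Fin n) (Unitization ℂ (cstarClosure s))) :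
    y.map (Unitization.starMap (g.comp (cstarInclusion s))) =
      (y.map (Unitization.starMap (cstarInclusion s))).map (Unitization.starMap g) := by
  rw [Unitization.starMap_comp, Matrix.map_map]
  rfl

theorem IsSeparablyHomotopicToId.K0Unital_map_eq_id {g : A →⋆ₙₐ[ℂ] A}
    (hg : IsSeparablyHomotopicToId g) :
    K0Unital.map (Unitization.starMap g) = AddMonoidHom.id _ := by
  refine K0Unital.hom_ext fun ⟨n, p, hp⟩ => ?_
  obtain ⟨s, hs, y, rfl⟩ := exists_map_cstarInclusion_eq p
  have hy := (isStarProjection_map_iff (starMap_cstarInclusion_injective s)).1 hp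
  -- The path stays among projections because each of its points is the image of the projection `y`
  -- under a unital `*`-homomorphism.
  have hj := (hg s hs).joinedIn_map y {r | IsStarProjection r}
    fun f => isStarProjection_map f hy
  rw [map_starMap_comp] at hj
  rw [K0Unital.map_mk_of, AddMonoidHom.id_apply, QuotientAddGroup.eq_iff_sub_mem]
  exact AddSubgroup.subset_closure (K0Rel.path _ _ _ _ hj)

theorem IsSeparablyHomotopicToId.K1Unital_map_eq_id {g : A →⋆ₙₐ[ℂ] A}
    (hg : IsSeparablyHomotopicToId g) :
    K1Unital.map (Unitization.starMap g) = AddMonoidHom.id _ := by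
  refine K1Unital.hom_ext fun ⟨n, w, hw⟩ => ?_
  obtain ⟨s, hs, y, rfl⟩ := exists_map_cstarInclusion_eq w
  have hy := (map_mem_unitary_iff (starMap_cstarInclusion_injective s)).1 hw
  have hj := (hg s hs).joinedIn_map y
    (unitary (Matrix (Fin n) (Fin n) (Unitization ℂ A)) : Set _) fun f => map_mem_unitary f hy
  rw [map_starMap_comp] at hj
  rw [K1Unital.map_mk_of, AddMonoidHom.id_apply, QuotientAddGroup.eq_iff_sub_mem]
  exact AddSubgroup.subset_closure (K1Rel.path _ _ _ _ hj)

/-- Unitized maps fix scalar parts; this makes the isomorphism on `K₀` of the unitizations respect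
the kernels defining `K₀`. -/
theorem augmentation_comp_starMap (g : A →⋆ₙₐ[ℂ] B) :
    (augmentation B).comp (Unitization.starMap g) = augmentation A := by
  refine StarAlgHom.ext fun x => ?_
  change (Unitization.starMap g x).fst = x.fst
  nth_rewrite 1 [← Unitization.inl_fst_add_inr_snd_eq x]
  rw [map_add, Unitization.starMap_inl, Unitization.starMap_inr, Unitization.fst_add,
    Unitization.fst_inr, add_zero]
  rfl

variable {f : A →⋆ₙₐ[ℂ] B} {g : B →⋆ₙₐ[ℂ] A}

/-- The isomorphism `K₀(A⁺) ≃ K₀(B⁺)` given by mutually inverse `*`-homomorphisms up to homotopy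
on separable C⋆-subalgebras. -/
noncomputable def K0UnitalEquiv (hgf : IsSeparablyHomotopicToId (g.comp f))
    (hfg : IsSeparablyHomotopicToId (f.comp g)) :
    K0Unital (Unitization ℂ A) ≃+ K0Unital (Unitization ℂ B) :=
  (K0Unital.map (Unitization.starMap f)).toAddEquiv (K0Unital.map (Unitization.starMap g))
    (by rw [← K0Unital.map_comp, ← Unitization.starMap_comp, hgf.K0Unital_map_eq_id])
    (by rw [← K0Unital.map_comp, ← Unitization.starMap_comp, hfg.K0Unital_map_eq_id])

/-- The isomorphism `K₁(A) ≃ K₁(B)` given by mutually inverse `*`-homomorphisms up to homotopy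
on separable C⋆-subalgebras. -/
noncomputable def K1Equiv (hgf : IsSeparablyHomotopicToId (g.comp f))
    (hfg : IsSeparablyHomotopicToId (f.comp g)) : K1 A ≃+ K1 B :=
  (K1Unital.map (Unitization.starMap f)).toAddEquiv (K1Unital.map (Unitization.starMap g))
    (by rw [← K1Unital.map_comp, ← Unitization.starMap_comp, hgf.K1Unital_map_eq_id])
    (by rw [← K1Unital.map_comp, ← Unitization.starMap_comp, hfg.K1Unital_map_eq_id])

theorem map_ker_augmentation (hgf : IsSeparablyHomotopicToId (g.comp f))
    (hfg : IsSeparablyHomotopicToId (f.comp g)) :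
    (K0Unital.map (augmentation A)).ker.map (K0UnitalEquiv hgf hfg).toAddMonoidHom =
      (K0Unital.map (augmentation B)).ker := by
  -- The image under an isomorphism is the preimage under its inverse, here induced by `g`, so only
  -- the augmentation identity for `g` is needed.
  rw [AddSubgroup.map_equiv_eq_comap_symm', AddMonoidHom.comap_ker]
  congr 1
  change (K0Unital.map (augmentation A)).comp (K0Unital.map (Unitization.starMap g)) = _
  rw [← K0Unital.map_comp, augmentation_comp_starMap]

/-- The isomorphism `K₀(A) ≃ K₀(B)` given by mutually inverse `*`-homomorphisms up to homotopy
on separable C⋆-subalgebras. -/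
noncomputable def K0Equiv (hgf : IsSeparablyHomotopicToId (g.comp f))
    (hfg : IsSeparablyHomotopicToId (f.comp g)) : K0 A ≃+ K0 B :=
  ((K0UnitalEquiv hgf hfg).addSubgroupMap _).trans
    (AddEquiv.addSubgroupCongr (map_ker_augmentation hgf hfg))

/-- Apply the hypothesis to the inclusion of a separable subalgebra and rewrite `φ` and `ψ` as
compositions. -/
theorem isSeparablyHomotopicToId_glue_comp_glue {φ : SeparableHomMap A B} {ψ : SeparableHomMap B A}
    (hφ : φ.IsNatural) (hψ : ψ.IsNatural)
    (h : ∀ (C : Type u) [NonUnitalCStarAlgebra C] [TopologicalSpace.SeparableSpace C]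
      (f : C →⋆ₙₐ[ℂ] A), StarHomotopic (ψ C (φ C f)) f) :
    IsSeparablyHomotopicToId ((ψ.glue hψ).comp (φ.glue hφ)) := fun s hs => by
  have := separableSpace_cstarClosure hs
  have h' := h (cstarClosure s) (cstarInclusion s)
  rwa [hφ.eq_glue_comp, hψ.eq_glue_comp, ← NonUnitalStarAlgHom.comp_assoc] at h'

end SeparableHomotopy

end KTheory

theorem mainTheorem10 {A B : Type u} [NonUnitalCStarAlgebra A] [NonUnitalCStarAlgebra B]
    (h : WeaklyHomotopyEquivalent A B) :
    Nonempty (KTheory.K0 A ≃+ KTheory.K0 B) ∧ Nonempty (KTheory.K1 A ≃+ KTheory.K1 B) := by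
  obtain ⟨φ, ψ, hφ, hψ, -, -, hψφ, hφψ⟩ := h
  have h₁ := KTheory.isSeparablyHomotopicToId_glue_comp_glue hφ hψ hψφ
  have h₂ := KTheory.isSeparablyHomotopicToId_glue_comp_glue hψ hφ hφψ
  exact ⟨⟨KTheory.K0Equiv h₁ h₂⟩, ⟨KTheory.K1Equiv h₁ h₂⟩⟩
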